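/- Let $A$ be a finite local Gorenstein $\mathbb{C}$-algebra with maximal ideal $\mathfrak m$; Gorenstein means that the socle $\operatorname{Ann}(\mathfrak m)$ has rank one over $\mathbb{C}$. Let $j$ be its socle degree, that is, the largest $l$ with $\mathfrak m^l\neq 0$. For $m,n\ge 0$ put $A_{m,n}=\mathfrak m^m\cap\operatorname{Ann}(\mathfrak m^n)$ and $Q_{m,n}=A_{m,n}/(A_{m+1,n}+A_{m,n-1})$ (non-positive powers of $\mathfrak m$ are the whole ring). The Hilbert function decomposition of $A$ consists of the vectors $\Delta_{A,s}$, $0\le s\le j$, with entries $\Delta_{A,s}(t)=\dim_{\mathbb{C}}Q_{t,\,j+1-(s+t)}$ for $0\le t\le j-s$. Suppose that $j\ge 3$ and $\Delta_{A,j-2}=(0,e,0)$ with $e>0$. Then there is a finite local Gorenstein $\mathbb{C}$-algebra $B$ of socle degree $j$ such that $\Delta_{B,s}=\Delta_{A,s}$ for all $s\neq j-2$ and $\Delta_{B,j-2}=(0,e-1,0)$, and such that $\operatorname{Spec}A$ is a flat degeneration of schemes isomorphic to $\operatorname{Spec}\mathbb{C}\sqcup\operatorname{Spec}B$: there is a finite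 flat morphism $Y\to\operatorname{Spec}\mathbb{C}[t]$ whose fibre over $t=0$ is isomorphic to $\operatorname{Spec}A$ over $\mathbb{C}$, and whose fibre over $t=\lambda$ is isomorphic to $\operatorname{Spec}\mathbb{C}\sqcup\operatorname{Spec}B$ over $\mathbb{C}$ for every $\lambda\in\mathbb{C}\setminus\{0\}$. -/

import Mathlib

open CategoryTheory CategoryTheory.Limits AlgebraicGeometry

namespace GorensteinDegeneration

section Algebra

variable (k A : Type*) [Field k] [CommRing A] [IsLocalRing A] [Algebra k A]

/-- The Loewy ideal `(𝔪 ^ n)^⊥ = Ann (𝔪 ^ n)` of a local ring `(A, 𝔪)`. -/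
def loewy (n : ℕ) : Ideal A :=
  Submodule.annihilator (IsLocalRing.maximalIdeal A ^ n)

/-- The socle of a local ring `(A, 𝔪)`: the annihilator of `𝔪`. -/
def socle : Ideal A :=
  Submodule.annihilator (IsLocalRing.maximalIdeal A)

/-- A finite local `k`-algebra with residue field `k` is Gorenstein when its socle has rank one
over `k`. -/
def IsGorenstein : Prop :=
  Module.finrank k (socle A) = 1

/-- `j` is the socle degree of `(A, 𝔪)`: the largest `l` such that `𝔪 ^ l ≠ 0`. -/
def HasSocleDegree (j : ℕ) : Prop :=
  IsGreatest {l : ℕ | IsLocalRing.maximalIdeal A ^ l ≠ ⊥} j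

/-- The ideal `A_{m, n} = 𝔪 ^ m ∩ (𝔪 ^ n)^⊥`. -/
def iaIdeal (m n : ℕ) : Ideal A :=
  IsLocalRing.maximalIdeal A ^ m ⊓ loewy A n

/-- The rank over `k` of `Q_{m, n} = A_{m, n} / (A_{m + 1, n} + A_{m, n - 1})`. For `n = 0` the
truncated subtraction is harmless: non-positive powers of `𝔪` are the whole ring, so that
`A_{m, -1} = A_{m, 0} = 0`. -/
noncomputable def iaRank (m n : ℕ) : ℕ :=
  Module.finrank k
    (iaIdeal A m n ⧸ (iaIdeal A (m + 1) n ⊔ iaIdeal A m (n - 1)).submoduleOf (iaIdeal A m n))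

/-- The entry `Δ_{A, s}(t)` of the Hilbert function decomposition of a finite local Gorenstein
`k`-algebra `A` of socle degree `j`: the rank of `Q_{t, j + 1 - (s + t)}` if `0 ≤ s ≤ j` and
`0 ≤ t ≤ j - s`, and zero otherwise. -/
noncomputable def hilbertDecomp (j s t : ℕ) : ℕ :=
  if s + t ≤ j then iaRank k A t (j + 1 - (s + t)) else 0

end Algebra

section Schemes

universe u

/-- `Spec A` as a scheme over `Spec k`. -/
noncomputable def specOver (k A : Type u) [Field k] [CommRing A] [Algebra k A] :
    Over (Spec (CommRingCat.of k)) :=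
  Over.mk (Spec.map (CommRingCat.ofHom (algebraMap k A)))

/-- The disjoint union of two schemes over `S`. -/
noncomputable def disjointUnion {S : Scheme.{u}} (X Y : Over S) : Over S :=
  Over.mk (coprod.desc X.hom Y.hom)

/-- The closed point `c` of the affine line `Spec k[t]`, as a morphism `Spec k ⟶ Spec k[t]`. -/
noncomputable def linePoint (k : Type u) [Field k] (c : k) :
    Spec (CommRingCat.of k) ⟶ Spec (CommRingCat.of (Polynomial k)) :=
  Spec.map (CommRingCat.ofHom (Polynomial.evalRingHom c))

/-- The fibre of a family over the affine line at the closed point `c`, as a scheme over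
`Spec k`. -/
noncomputable def fibreAt {k : Type u} [Field k] {Y : Scheme.{u}}
    (π : Y ⟶ Spec (CommRingCat.of (Polynomial k))) (c : k) : Over (Spec (CommRingCat.of k)) :=
  Over.mk (pullback.snd π (linePoint k c))

/-- The `k`-scheme `X` is a flat degeneration of (schemes isomorphic to) the `k`-scheme `Z`:
there is a finite flat family over the affine line whose fibre at `0` is isomorphic to `X` and
whose fibre at every closed point `c ≠ 0` is isomorphic to `Z`. -/
def IsFlatDegeneration {k : Type u} [Field k] (X Z : Over (Spec (CommRingCat.of k))) : Prop :=
  ∃ (Y : Scheme.{u}) (π : Y ⟶ Spec (CommRingCat.of (Polynomial k))),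
    Flat π ∧ IsFinite π ∧
      Nonempty (fibreAt π 0 ≅ X) ∧ ∀ c : k, c ≠ 0 → Nonempty (fibreAt π c ≅ Z)

end Schemes

end GorensteinDegeneration

/-! Since `Δ_{A,j-2}(1) = e` is the rank of `Q_{1,2}`, there are elements of `𝔪` killed by `𝔪²` that
do not come from `A_{2,2} + A_{1,1}`. Products of elements of `A_{1,2}` lie in the socle, so
multiplication is a symmetric form on `A_{1,2}`. If all squares vanished, polarization would make
the form zero, and the double annihilator property would put `A_{1,2}` inside `𝔪²`, forcing `Q_{1,2}
= 0`. Hence some `x` in `A_{1,2}` has `x² ≠ 0`, a generator of the socle (`exists_isSplitting`).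

Take `B = k + Ann x`. Then `A = B ⊕ k x`, and the powers of the maximal ideal of `B` and its Loewy
ideals are the traces of those of `A`. Each `A_{m,n}` is its trace on `B`, plus `k x` when it
contains `x`; so only `Q_{1,2}` changes, and its rank drops by one (`iaRank_eq`).

Finally `A` is `B[x]` with relations `x² = u`, `x · ker ε = 0`, where `u` is the socle generator.
Replacing the first relation by `x² = τ x + u` gives a free family over `k[τ]`
(`isFlatDegeneration_glue`). For `τ ≠ 0` the element `τ⁻¹(x + τ⁻¹u)` is idempotent and splits off a
reduced point, leaving `B`. -/

namespace GorensteinDegeneration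

/-! ### The subalgebra `B = k + Ann x`: its maximal ideal, powers and Loewy ideals. -/

section Splitting

open IsLocalRing

variable {k A : Type*} [Field k] [CommRing A] [IsLocalRing A] [Algebra k A]

/-- An element `x` of the maximal ideal which spans, together with `k` and its own annihilator,
the local `k`-algebra `A` with residue map `ε`: it kills `𝔪 ^ 2`, and its square is a generator of
the socle, lying in `𝔪 ^ 3`. -/
structure IsSplitting (ε : A →ₐ[k] k) (x : A) : Prop where
  eps_eq_zero_iff : ∀ a, ε a = 0 ↔ a ∈ maximalIdeal A
  mem : x ∈ maximalIdeal A
  mul_eq_zero : ∀ a ∈ maximalIdeal A ^ 2, a * x = 0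
  sq_ne_zero : x * x ≠ 0
  sq_mem : x * x ∈ maximalIdeal A ^ 3
  exists_smul_of_mem_socle : ∀ a, (∀ b ∈ maximalIdeal A, a * b = 0) → ∃ c : k, a = c • (x * x)

/-- The subalgebra `k + Ann x` of `A`. -/
def annSubalgebra (ε : A →ₐ[k] k) (x : A) : Subalgebra k A where
  carrier := {a | a * x = ε a • x}
  mul_mem' {a b} ha hb := by
    simp only [Set.mem_ofPred_eq] at *
    rw [mul_assoc, hb, mul_smul_comm, ha, smul_smul, map_mul, mul_comm]
  add_mem' {a b} ha hb := by
    simp only [Set.mem_ofPred_eq] at *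
    rw [add_mul, ha, hb, map_add, add_smul]
  algebraMap_mem' c := by
    simp [Algebra.smul_def]

omit [IsLocalRing A] in
lemma mem_annSubalgebra {ε : A →ₐ[k] k} {x a : A} : a ∈ annSubalgebra ε x ↔ a * x = ε a • x :=
  Iff.rfl

/-- If `a x = ε(a) x` and `a v = 1`, then `v x = ε(v) x`: inverses stay in the subalgebra, which is
therefore local. -/
instance isLocalHom_annSubalgebra_val (ε : A →ₐ[k] k) (x : A) :
    IsLocalHom (annSubalgebra ε x).val.toRingHom where
  map_nonunit a ha := by
    have ha' : IsUnit (a : A) := ha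
    obtain ⟨v, hv⟩ := ha'.exists_right_inv
    have hεv : ε a * ε v = 1 := by rw [← map_mul, hv, map_one]
    have ha2 : (a : A) * x = ε a • x := a.2
    have hvm : v ∈ annSubalgebra ε x := by
      rw [mem_annSubalgebra]
      calc v * x = (ε a * ε v) • (v * x) := by rw [hεv, one_smul]
        _ = ε v • (v * (ε a • x)) := by rw [mul_smul_comm, smul_smul, mul_comm]
        _ = ε v • ((a * v) * x) := by rw [← ha2]; congr 1; ring
        _ = ε v • x := by rw [hv, one_mul]
    exact IsUnit.of_mul_eq_one ⟨v, hvm⟩ (Subtype.ext hv)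

instance isLocalRing_annSubalgebra (ε : A →ₐ[k] k) (x : A) : IsLocalRing (annSubalgebra ε x) :=
  RingHom.domain_isLocalRing (annSubalgebra ε x).val.toRingHom

lemma mem_maximalIdeal_annSubalgebra {ε : A →ₐ[k] k} {x : A} {b : annSubalgebra ε x} :
    b ∈ maximalIdeal (annSubalgebra ε x) ↔ (b : A) ∈ maximalIdeal A := by
  rw [mem_maximalIdeal, mem_maximalIdeal, mem_nonunits_iff, mem_nonunits_iff, not_iff_not]
  exact (isUnit_map_iff (annSubalgebra ε x).val.toRingHom b).symm

lemma coe_mem_pow_of_mem_pow {ε : A →ₐ[k] k} {x : A} {n : ℕ} {b : annSubalgebra ε x}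
    (hb : b ∈ maximalIdeal (annSubalgebra ε x) ^ n) : (b : A) ∈ maximalIdeal A ^ n := by
  have h : maximalIdeal (annSubalgebra ε x) ≤
      (maximalIdeal A).comap (annSubalgebra ε x).val.toRingHom :=
    fun b hb => mem_maximalIdeal_annSubalgebra.1 hb
  exact (Ideal.pow_right_mono h n).trans (Ideal.le_comap_pow _ n) hb

namespace IsSplitting

variable {ε : A →ₐ[k] k} {x : A} (h : IsSplitting ε x)
include h

lemma sq_mul_eq_zero {a : A} (ha : a ∈ maximalIdeal A) : x * x * a = 0 := by
  rw [mul_assoc, mul_comm]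
  exact h.mul_eq_zero _ (by rw [pow_two]; exact Ideal.mul_mem_mul h.mem ha)

lemma sub_eps_mem (a : A) : a - algebraMap k A (ε a) ∈ maximalIdeal A := by
  rw [← h.eps_eq_zero_iff]; simp

lemma not_mem_annSubalgebra : x ∉ annSubalgebra ε x := by
  intro hx
  rw [mem_annSubalgebra, (h.eps_eq_zero_iff x).2 h.mem, zero_smul] at hx
  exact h.sq_ne_zero hx

/-- The product `(a - ε(a)) x` is killed by `𝔪` because `x` is killed by `𝔪²`; it is thus a multiple
`c x²` of the socle generator. This gives `A = B + k x`. -/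
lemma exists_sub_smul_mem (a : A) : ∃ c : k, a - c • x ∈ annSubalgebra ε x := by
  obtain ⟨c, hc⟩ := h.exists_smul_of_mem_socle ((a - algebraMap k A (ε a)) * x) (fun b hb => by
    rw [mul_right_comm]
    exact h.mul_eq_zero _ (by rw [pow_two]; exact Ideal.mul_mem_mul (h.sub_eps_mem a) hb))
  refine ⟨c, ?_⟩
  rw [mem_annSubalgebra, map_sub, map_smul, (h.eps_eq_zero_iff x).2 h.mem, smul_zero, sub_zero,
    sub_mul, smul_mul_assoc, ← hc, sub_mul, Algebra.smul_def]
  ring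

lemma exists_add_smul (a : A) (ha : a ∈ maximalIdeal A) :
    ∃ (b : annSubalgebra ε x) (c : k),
      b ∈ maximalIdeal (annSubalgebra ε x) ∧ (b : A) * x = 0 ∧ a = b + c • x := by
  obtain ⟨c, hc⟩ := h.exists_sub_smul_mem a
  have hm : a - c • x ∈ maximalIdeal A :=
    sub_mem ha (by rw [Algebra.smul_def]; exact Ideal.mul_mem_left _ _ h.mem)
  refine ⟨⟨_, hc⟩, c, mem_maximalIdeal_annSubalgebra.2 hm, ?_, by simp⟩
  have := mem_annSubalgebra.1 hc
  rwa [(h.eps_eq_zero_iff _).2 hm, zero_smul] at this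

/-- In `(b + c x)(b' + c' x)` with `b x = b' x = 0` the cross terms vanish, leaving `b b' + c c'
x²`. The `x²` term is tolerated here because it is not yet known to lie in a power of the maximal
ideal of `B`. -/
lemma exists_add_smul_sq_of_mem_pow (n : ℕ) {a : A} (ha : a ∈ maximalIdeal A ^ (n + 2)) :
    ∃ (b : annSubalgebra ε x) (c : k), b ∈ maximalIdeal (annSubalgebra ε x) ^ (n + 2) ∧
      a = b + c • (x * x) := by
  have hadd (m : ℕ) (a a' : A) : (∃ (b : annSubalgebra ε x) (c : k),
      b ∈ maximalIdeal (annSubalgebra ε x) ^ (m + 2) ∧ a = b + c • (x * x)) →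
      (∃ (b : annSubalgebra ε x) (c : k), b ∈ maximalIdeal (annSubalgebra ε x) ^ (m + 2) ∧
      a' = b + c • (x * x)) → (∃ (b : annSubalgebra ε x) (c : k),
      b ∈ maximalIdeal (annSubalgebra ε x) ^ (m + 2) ∧ a + a' = b + c • (x * x)) := by
    rintro ⟨b, c, hb, rfl⟩ ⟨b', c', hb', rfl⟩
    exact ⟨b + b', c + c', add_mem hb hb', by push_cast; rw [add_smul]; ring⟩
  induction n generalizing a with
  | zero =>
    rw [zero_add, pow_two] at ha
    refine Submodule.mul_induction_on ha (fun p hp q hq => ?_) (hadd 0)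
    obtain ⟨b, c, hb, hbx, rfl⟩ := h.exists_add_smul p hp
    obtain ⟨b', c', hb', hbx', rfl⟩ := h.exists_add_smul q hq
    refine ⟨b * b', c * c', by rw [zero_add, pow_two]; exact Ideal.mul_mem_mul hb hb', ?_⟩
    simp only [Algebra.smul_def, map_mul, MulMemClass.coe_mul]
    linear_combination (algebraMap k A c') * hbx + (algebraMap k A c) * hbx'
  | succ n ih =>
    rw [pow_succ] at ha
    refine Submodule.mul_induction_on ha (fun p hp q hq => ?_) (hadd (n + 1))
    obtain ⟨b, c, hb, rfl⟩ := ih hp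
    have hbx : (b : A) * x = 0 :=
      h.mul_eq_zero _ (Ideal.pow_le_pow_right (by omega) (coe_mem_pow_of_mem_pow hb))
    have hq' := h.sq_mul_eq_zero hq
    obtain ⟨b', c', hb', hbx', rfl⟩ := h.exists_add_smul q hq
    refine ⟨b * b', 0, by rw [add_right_comm, pow_succ]; exact Ideal.mul_mem_mul hb hb', ?_⟩
    simp only [Algebra.smul_def, map_zero, MulMemClass.coe_mul] at hq' ⊢
    linear_combination (algebraMap k A c) * hq' + (algebraMap k A c') * hbx

/-- One further factor from `𝔪` kills the stray `x²` term. -/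
lemma exists_of_mem_pow_of_three_le {n : ℕ} (hn : 3 ≤ n) {a : A} (ha : a ∈ maximalIdeal A ^ n) :
    ∃ b ∈ maximalIdeal (annSubalgebra ε x) ^ n, (b : A) = a := by
  obtain ⟨n, rfl⟩ := Nat.exists_eq_add_of_le' hn
  rw [show n + 3 = n + 2 + 1 from rfl, pow_succ] at ha
  refine Submodule.mul_induction_on ha (fun p hp q hq => ?_) ?_
  · obtain ⟨b, c, hb, rfl⟩ := h.exists_add_smul_sq_of_mem_pow n hp
    have hbx : (b : A) * x = 0 :=
      h.mul_eq_zero _ (Ideal.pow_le_pow_right (by omega) (coe_mem_pow_of_mem_pow hb))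
    have hq' := h.sq_mul_eq_zero hq
    obtain ⟨b', c', hb', hbx', rfl⟩ := h.exists_add_smul q hq
    refine ⟨b * b', by rw [show n + 3 = n + 2 + 1 from rfl, pow_succ];
                       exact Ideal.mul_mem_mul hb hb', ?_⟩
    simp only [Algebra.smul_def, MulMemClass.coe_mul] at hq' ⊢
    linear_combination -(algebraMap k A c) * hq' - (algebraMap k A c') * hbx
  · rintro _ _ ⟨b, hb, rfl⟩ ⟨b', hb', rfl⟩
    exact ⟨b + b', add_mem hb hb', rfl⟩

lemma exists_of_mem_pow {n : ℕ} (hn : 2 ≤ n) {a : A} (ha : a ∈ maximalIdeal A ^ n) :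
    ∃ b ∈ maximalIdeal (annSubalgebra ε x) ^ n, (b : A) = a := by
  rcases hn.eq_or_lt with rfl | hn
  · obtain ⟨b, c, hb, rfl⟩ := h.exists_add_smul_sq_of_mem_pow 0 ha
    -- Here `x² ∈ 𝔪³` is used: the cubic case puts `x²` in the cube of the maximal ideal of `B`,
    -- which absorbs the remaining term in degree two.
    obtain ⟨b', hb', hxx⟩ := h.exists_of_mem_pow_of_three_le le_rfl h.sq_mem
    refine ⟨b + c • b', add_mem hb ?_, by simp [hxx]⟩
    rw [Algebra.smul_def]
    exact Ideal.mul_mem_left _ _ (Ideal.pow_le_pow_right (by omega) hb')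
  · exact h.exists_of_mem_pow_of_three_le hn ha

lemma mem_maximalIdeal_pow_iff {n : ℕ} {b : annSubalgebra ε x} :
    b ∈ maximalIdeal (annSubalgebra ε x) ^ n ↔ (b : A) ∈ maximalIdeal A ^ n := by
  refine ⟨coe_mem_pow_of_mem_pow, fun hb => ?_⟩
  match n, hb with
  | 0, _ => simp
  | 1, hb => rw [pow_one] at hb ⊢; exact mem_maximalIdeal_annSubalgebra.2 hb
  | n + 2, hb =>
    obtain ⟨b', hb', hbb⟩ := h.exists_of_mem_pow (by omega) hb
    rwa [← Subtype.ext hbb]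

lemma sq_mem_annSubalgebra : x * x ∈ annSubalgebra ε x := by
  rw [mem_annSubalgebra, h.sq_mul_eq_zero h.mem, map_mul, (h.eps_eq_zero_iff x).2 h.mem]
  simp

/-- For exponents at least 2 the two powers coincide as sets. In exponent 1 the extra generator `x`
must also be killed. -/
lemma mem_loewy_iff {n : ℕ} {b : annSubalgebra ε x} :
    b ∈ loewy (annSubalgebra ε x) n ↔ (b : A) ∈ loewy A n := by
  simp only [loewy, Submodule.mem_annihilator, smul_eq_mul]
  constructor
  · intro hb a ha
    match n, ha with
    | 0, _ =>
      have := congrArg Subtype.val (hb 1 (by simp))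
      rw [mul_one] at this
      rw [this]; simp
    | 1, ha =>
      rw [pow_one] at ha
      simp only [pow_one] at hb
      obtain ⟨b', c, hb', -, rfl⟩ := h.exists_add_smul a ha
      have h1 : (b : A) * b' = 0 := congrArg Subtype.val (hb b' hb')
      -- As `x²` lies in the maximal ideal of `B`, `b x² = 0`; this equals `ε(b) x²`, so `ε(b) = 0`
      -- and `b x = 0`.
      have h2 : (b : A) * (x * x) = 0 := congrArg Subtype.val
        (hb ⟨x * x, h.sq_mem_annSubalgebra⟩
          (mem_maximalIdeal_annSubalgebra.2 (Ideal.mul_mem_left _ _ h.mem)))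
      have h3 : ε b • (x * x) = 0 := by
        rw [← smul_mul_assoc, ← mem_annSubalgebra.1 b.2, mul_assoc, h2]
      have h4 : (b : A) * x = 0 := by
        rw [mem_annSubalgebra.1 b.2, (smul_eq_zero.1 h3).resolve_right h.sq_ne_zero, zero_smul]
      rw [mul_add, h1, mul_smul_comm, h4, smul_zero, add_zero]
    | n + 2, ha =>
      obtain ⟨b', hb', rfl⟩ := h.exists_of_mem_pow (by omega) ha
      exact congrArg Subtype.val (hb b' hb')
  · intro hb b' hb'
    exact Subtype.ext (hb b' (coe_mem_pow_of_mem_pow hb'))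

lemma mem_iaIdeal_iff {m n : ℕ} {b : annSubalgebra ε x} :
    b ∈ iaIdeal (annSubalgebra ε x) m n ↔ (b : A) ∈ iaIdeal A m n := by
  simp only [iaIdeal, Submodule.mem_inf, h.mem_maximalIdeal_pow_iff, h.mem_loewy_iff]

lemma mem_socle_iff {b : annSubalgebra ε x} :
    b ∈ socle (annSubalgebra ε x) ↔ (b : A) ∈ socle A := by
  have := h.mem_loewy_iff (n := 1) (b := b)
  rwa [loewy, loewy, pow_one, pow_one] at this

lemma self_mem_iaIdeal_iff {m n : ℕ} : x ∈ iaIdeal A m n ↔ m ≤ 1 ∧ 2 ≤ n := by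
  have h2 : x ∉ maximalIdeal A ^ 2 := fun hx => h.sq_ne_zero (h.mul_eq_zero x hx)
  simp only [iaIdeal, Submodule.mem_inf, loewy, Submodule.mem_annihilator, smul_eq_mul]
  constructor
  · rintro ⟨hm, hn⟩
    constructor
    · by_contra! hlt
      exact h2 (Ideal.pow_le_pow_right hlt hm)
    · by_contra! hlt
      exact h.sq_ne_zero (hn x (Ideal.pow_le_pow_right (show n ≤ 1 by omega)
        (by simpa using h.mem)))
  · rintro ⟨hm, hn⟩
    refine ⟨Ideal.pow_le_pow_right hm (by simpa using h.mem), fun a ha => ?_⟩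
    rw [mul_comm]
    exact h.mul_eq_zero a (Ideal.pow_le_pow_right hn ha)

/-- Either `m ≥ 2` and `𝔪² ⊆ B`, or `n ≤ 1` and the ideal lies in the socle `k x² ⊆ B`. -/
lemma mem_annSubalgebra_of_mem_iaIdeal {m n : ℕ} (hx : x ∉ iaIdeal A m n) {a : A}
    (ha : a ∈ iaIdeal A m n) : a ∈ annSubalgebra ε x := by
  rw [h.self_mem_iaIdeal_iff, not_and_or, not_le, not_le] at hx
  rcases hx with hm | hn
  · obtain ⟨b, -, rfl⟩ := h.exists_of_mem_pow hm ha.1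
    exact b.2
  · have hal : ∀ b ∈ maximalIdeal A, a * b = 0 := fun b hb =>
      Submodule.mem_annihilator.1 ha.2 b
        (Ideal.pow_le_pow_right (show n ≤ 1 by omega) (by simpa using hb))
    obtain ⟨c, rfl⟩ := h.exists_smul_of_mem_socle a hal
    exact Subalgebra.smul_mem _ h.sq_mem_annSubalgebra c

end IsSplitting

end Splitting

end GorensteinDegeneration

namespace GorensteinDegeneration

/-! ### Comparison of the ranks of `Q_{m,n}` for `A` and `B`; socle and socle degree of `B`. -/

section Rank

open IsLocalRing

variable {k A : Type*} [Field k] [CommRing A] [Algebra k A]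

lemma finrank_quotient_submoduleOf_add [Module.Finite k A] {I J : Ideal A} (hJI : J ≤ I) :
    Module.finrank k (I ⧸ J.submoduleOf I) + Module.finrank k J = Module.finrank k I := by
  rw [← Submodule.finrank_quotient_add_finrank ((J.submoduleOf I).restrictScalars k)]
  congr 1
  exact (((Submodule.submoduleOfEquivOfLe hJI).restrictScalars k).finrank_eq).symm

variable [IsLocalRing A]

lemma iaIdeal_succ_sup_le (m n : ℕ) :
    iaIdeal A (m + 1) n ⊔ iaIdeal A m (n - 1) ≤ iaIdeal A m n :=
  sup_le (inf_le_inf_right _ (Ideal.pow_le_pow_right m.le_succ))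
    (inf_le_inf_left _ (Submodule.annihilator_mono (Ideal.pow_le_pow_right (n.sub_le 1))))

namespace IsSplitting

variable {ε : A →ₐ[k] k} {x : A} (h : IsSplitting ε x)
include h

open scoped Classical in
lemma finrank_ideal [Module.Finite k A] {V : Ideal A} {W : Ideal (annSubalgebra ε x)}
    (hV : x ∉ V → ∀ a ∈ V, a ∈ annSubalgebra ε x) (hW : ∀ b, b ∈ W ↔ (b : A) ∈ V) :
    Module.finrank k V = Module.finrank k W + if x ∈ V then 1 else 0 := by
  let f : W →ₗ[k] V :=
    { toFun := fun b => ⟨(b : annSubalgebra ε x), (hW _).1 b.2⟩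
      map_add' := fun _ _ => rfl
      map_smul' := fun _ _ => rfl }
  have hf : Function.Injective f := fun b c hbc =>
    Subtype.ext (Subtype.ext (congrArg (fun y : V => (y : A)) hbc))
  split_ifs with hx
  · let g : (W × k) →ₗ[k] V := f.coprod (LinearMap.toSpanSingleton k V ⟨x, hx⟩)
    have hg (p : W × k) : (g p : A) = ((p.1 : annSubalgebra ε x) : A) + p.2 • x := rfl
    have hbij : Function.Bijective g := by
      constructor
      · rw [injective_iff_map_eq_zero]
        rintro ⟨b, c⟩ hbc
        have h0 : ((b : annSubalgebra ε x) : A) + c • x = 0 := by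
          rw [← hg (b, c), hbc]; rfl
        have hc : c = 0 := by
          by_contra hc
          apply h.not_mem_annSubalgebra
          have : x = (-c⁻¹) • ((b : annSubalgebra ε x) : A) := by
            rw [eq_neg_of_add_eq_zero_left h0, smul_neg, neg_smul, neg_neg, smul_smul,
              inv_mul_cancel₀ hc, one_smul]
          have hmem := (-c⁻¹ • (b : annSubalgebra ε x)).2
          rwa [Subalgebra.coe_smul, ← this] at hmem
        subst hc
        rw [zero_smul, add_zero] at h0
        exact Prod.ext (Subtype.ext (Subtype.ext h0)) rfl
      · rintro ⟨a, ha⟩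
        obtain ⟨c, hc⟩ := h.exists_sub_smul_mem a
        refine ⟨(⟨⟨_, hc⟩, (hW _).2 (sub_mem ha ?_)⟩, c), Subtype.ext ?_⟩
        · exact Submodule.smul_of_tower_mem V c hx
        · rw [hg]; simp
    rw [← (LinearEquiv.ofBijective g hbij).finrank_eq, Module.finrank_prod, Module.finrank_self]
  · refine (LinearEquiv.ofBijective f ⟨hf, ?_⟩).finrank_eq.symm
    rintro ⟨a, ha⟩
    exact ⟨⟨⟨a, hV hx a ha⟩, (hW _).2 ha⟩, rfl⟩

lemma exists_decomp {V : Ideal A} (hV : x ∉ V → ∀ a ∈ V, a ∈ annSubalgebra ε x) {a : A}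
    (ha : a ∈ V) : ∃ (b : annSubalgebra ε x) (c : k), (b : A) ∈ V ∧ a = b + c • x := by
  by_cases hx : x ∈ V
  · obtain ⟨c, hc⟩ := h.exists_sub_smul_mem a
    exact ⟨⟨_, hc⟩, c, sub_mem ha (Submodule.smul_of_tower_mem V c hx), by simp⟩
  · exact ⟨⟨a, hV hx a ha⟩, 0, ha, by simp⟩

/-- Traces on a subring need not commute with sums of ideals. Here each summand is compatible with
`A = B ⊕ k x`, so the `x`-coefficients of a sum lying in `B` cancel. -/
lemma mem_sup_iff {V₁ V₂ : Ideal A} {W₁ W₂ : Ideal (annSubalgebra ε x)}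
    (hV₁ : x ∉ V₁ → ∀ a ∈ V₁, a ∈ annSubalgebra ε x) (hW₁ : ∀ b, b ∈ W₁ ↔ (b : A) ∈ V₁)
    (hV₂ : x ∉ V₂ → ∀ a ∈ V₂, a ∈ annSubalgebra ε x) (hW₂ : ∀ b, b ∈ W₂ ↔ (b : A) ∈ V₂)
    (b : annSubalgebra ε x) : b ∈ W₁ ⊔ W₂ ↔ (b : A) ∈ V₁ ⊔ V₂ := by
  constructor
  · intro hb
    obtain ⟨b₁, hb₁, b₂, hb₂, rfl⟩ := Submodule.mem_sup.1 hb
    exact Submodule.add_mem_sup ((hW₁ _).1 hb₁) ((hW₂ _).1 hb₂)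
  · intro hb
    obtain ⟨a₁, ha₁, a₂, ha₂, hab⟩ := Submodule.mem_sup.1 hb
    obtain ⟨b₁, c₁, hb₁, rfl⟩ := h.exists_decomp hV₁ ha₁
    obtain ⟨b₂, c₂, hb₂, rfl⟩ := h.exists_decomp hV₂ ha₂
    have hsum : ((b - (b₁ + b₂) : annSubalgebra ε x) : A) = (c₁ + c₂) • x := by
      push_cast; rw [← hab, add_smul]; ring
    have hc : c₁ + c₂ = 0 := by
      by_contra hc
      apply h.not_mem_annSubalgebra
      have : x = (c₁ + c₂)⁻¹ • ((b - (b₁ + b₂) : annSubalgebra ε x) : A) := by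
        rw [hsum, smul_smul, inv_mul_cancel₀ hc, one_smul]
      have hmem := ((c₁ + c₂)⁻¹ • (b - (b₁ + b₂))).2
      rwa [Subalgebra.coe_smul, ← this] at hmem
    rw [hc, zero_smul] at hsum
    rw [sub_eq_zero.1 (Subtype.ext hsum : b - (b₁ + b₂) = 0)]
    exact Submodule.add_mem_sup ((hW₁ _).2 hb₁) ((hW₂ _).2 hb₂)

/-- If neither summand contains `x`, both lie in `B`, which does not contain `x`. -/
lemma self_mem_sup_iff {m n : ℕ} :
    x ∈ iaIdeal A (m + 1) n ⊔ iaIdeal A m (n - 1) ↔ (m = 0 ∧ 2 ≤ n) ∨ (m ≤ 1 ∧ 3 ≤ n) := by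
  constructor
  · intro hx
    by_contra hcon
    obtain ⟨a₁, ha₁, a₂, ha₂, hab⟩ := Submodule.mem_sup.1 hx
    apply h.not_mem_annSubalgebra
    refine (congrArg (· ∈ annSubalgebra ε x) hab).mp <| add_mem (h.mem_annSubalgebra_of_mem_iaIdeal ?_ ha₁)
      (h.mem_annSubalgebra_of_mem_iaIdeal ?_ ha₂) <;> rw [h.self_mem_iaIdeal_iff] <;> omega
  · rintro (hmn | hmn)
    · exact Submodule.mem_sup_left (h.self_mem_iaIdeal_iff.2 (by omega))
    · exact Submodule.mem_sup_right (h.self_mem_iaIdeal_iff.2 (by omega))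

/-- The line `k x` contributes to `Q_{m,n}` exactly when `x` is in the numerator but not in the
denominator, which singles out `(1, 2)`. -/
lemma iaRank_eq [Module.Finite k A] (m n : ℕ) :
    iaRank k A m n = iaRank k (annSubalgebra ε x) m n + if m = 1 ∧ n = 2 then 1 else 0 := by
  classical
  have hg (m n : ℕ) : x ∉ iaIdeal A m n → ∀ a ∈ iaIdeal A m n, a ∈ annSubalgebra ε x :=
    fun hx a ha => h.mem_annSubalgebra_of_mem_iaIdeal hx ha
  have h1 := h.finrank_ideal (hg m n) (fun b => h.mem_iaIdeal_iff)
  have h2 := h.finrank_ideal (V := iaIdeal A (m + 1) n ⊔ iaIdeal A m (n - 1))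
    (fun hx a ha => by
      obtain ⟨a₁, ha₁, a₂, ha₂, rfl⟩ := Submodule.mem_sup.1 ha
      exact add_mem (hg _ _ (fun h' => hx (Submodule.mem_sup_left h')) _ ha₁)
        (hg _ _ (fun h' => hx (Submodule.mem_sup_right h')) _ ha₂))
    (h.mem_sup_iff (hg _ _) (fun b => h.mem_iaIdeal_iff) (hg _ _) (fun b => h.mem_iaIdeal_iff))
  have h3 := finrank_quotient_submoduleOf_add (k := k) (iaIdeal_succ_sup_le (A := A) m n)
  have h4 := finrank_quotient_submoduleOf_add (k := k)
    (iaIdeal_succ_sup_le (A := annSubalgebra ε x) m n)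
  rw [h.self_mem_iaIdeal_iff] at h1
  rw [h.self_mem_sup_iff] at h2
  simp only [iaRank]
  split_ifs at * <;> omega

lemma hilbertDecomp_of_ne [Module.Finite k A] {j s : ℕ} (hj : 2 ≤ j) (hs : s ≠ j - 2) (t : ℕ) :
    hilbertDecomp k (annSubalgebra ε x) j s t = hilbertDecomp k A j s t := by
  simp only [hilbertDecomp, h.iaRank_eq]
  split_ifs <;> first | rfl | omega

lemma hilbertDecomp_eq [Module.Finite k A] {j : ℕ} (hj : 2 ≤ j) (t : ℕ) :
    hilbertDecomp k A j (j - 2) t =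
      hilbertDecomp k (annSubalgebra ε x) j (j - 2) t + if t = 1 then 1 else 0 := by
  simp only [hilbertDecomp, h.iaRank_eq]
  split_ifs <;> first | rfl | omega

lemma isGorenstein_annSubalgebra : IsGorenstein k (annSubalgebra ε x) := by
  have hm : ∀ b ∈ maximalIdeal A, x * x * b = 0 := fun b hb => h.sq_mul_eq_zero hb
  have hs : (⟨x * x, h.sq_mem_annSubalgebra⟩ : annSubalgebra ε x) ∈ socle (annSubalgebra ε x) :=
    h.mem_socle_iff.2 (Submodule.mem_annihilator.2 hm)
  refine (finrank_eq_one_iff_of_nonzero' (⟨_, hs⟩ : socle (annSubalgebra ε x)) ?_).2 ?_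
  · intro h0
    exact h.sq_ne_zero (congrArg (fun y : socle (annSubalgebra ε x) =>
      ((y : annSubalgebra ε x) : A)) h0)
  · intro w
    obtain ⟨c, hc⟩ := h.exists_smul_of_mem_socle _
      (Submodule.mem_annihilator.1 (h.mem_socle_iff.1 w.2))
    exact ⟨c, Subtype.ext (Subtype.ext hc.symm)⟩

lemma hasSocleDegree_annSubalgebra {j : ℕ} (hj : 2 ≤ j) (hA : HasSocleDegree A j) :
    HasSocleDegree (annSubalgebra ε x) j := by
  constructor
  · intro hbot
    obtain ⟨a, ha, ha0⟩ := Submodule.exists_mem_ne_zero_of_ne_bot hA.1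
    obtain ⟨b, hb, rfl⟩ := h.exists_of_mem_pow hj ha
    rw [hbot, Submodule.mem_bot] at hb
    exact ha0 (by rw [hb]; rfl)
  · intro l hl
    obtain ⟨b, hb, hb0⟩ := Submodule.exists_mem_ne_zero_of_ne_bot hl
    refine hA.2 (fun hbot => hb0 (Subtype.ext ?_))
    have := coe_mem_pow_of_mem_pow hb
    rwa [hbot, Submodule.mem_bot] at this

end IsSplitting

end Rank

/-! ### Gorenstein duality and the existence of `x`. -/

section Existence

open IsLocalRing

variable {k A : Type*} [Field k] [CommRing A] [IsLocalRing A] [Algebra k A]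

lemma HasSocleDegree.pow_succ_eq_bot {j : ℕ} (h : HasSocleDegree A j) :
    maximalIdeal A ^ (j + 1) = ⊥ := by
  by_contra hne
  exact absurd (h.2 hne) (by omega)

lemma HasSocleDegree.pow_le_socle {j : ℕ} (h : HasSocleDegree A j) :
    maximalIdeal A ^ j ≤ socle A := fun a ha => Submodule.mem_annihilator.2 fun b hb => by
  have : a * b ∈ maximalIdeal A ^ (j + 1) := pow_succ (maximalIdeal A) j ▸ Ideal.mul_mem_mul ha hb
  rwa [h.pow_succ_eq_bot, Submodule.mem_bot] at this

/-- The last nonzero ideal among the `𝔪ⁿ I` is killed by `𝔪`. -/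
lemma HasSocleDegree.exists_mem_socle {j : ℕ} (h : HasSocleDegree A j) {I : Ideal A}
    (hI : I ≠ ⊥) : ∃ a ∈ I, a ∈ socle A ∧ a ≠ 0 := by
  obtain ⟨n, hn, hspec⟩ : ∃ n, maximalIdeal A ^ n * I ≠ ⊥ ∧ maximalIdeal A ^ (n + 1) * I = ⊥ := by
    by_contra! hcon
    have hne (n : ℕ) : maximalIdeal A ^ n * I ≠ ⊥ := by
      induction n with
      | zero => rwa [pow_zero, Ideal.one_eq_top, Ideal.top_mul]
      | succ n ih => exact hcon n ih
    exact hne (j + 1) (by rw [h.pow_succ_eq_bot, Ideal.bot_mul])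
  obtain ⟨a, ha, ha0⟩ := Submodule.exists_mem_ne_zero_of_ne_bot hn
  have hle : maximalIdeal A ^ n * I ≤ I := Ideal.mul_le_right
  refine ⟨a, hle ha, ?_, ha0⟩
  rw [socle, Submodule.mem_annihilator]
  intro b hb
  rw [pow_succ', mul_assoc] at hspec
  have : b * a ∈ maximalIdeal A * (maximalIdeal A ^ n * I) := Ideal.mul_mem_mul hb ha
  rw [hspec, Submodule.mem_bot] at this
  rw [smul_eq_mul, mul_comm, this]

lemma IsGorenstein.exists_smul_eq (h : IsGorenstein k A) {u a : A} (hu : u ∈ socle A)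
    (hu0 : u ≠ 0) (ha : a ∈ socle A) : ∃ c : k, a = c • u := by
  obtain ⟨c, hc⟩ := (finrank_eq_one_iff_of_nonzero' (⟨u, hu⟩ : socle A)
    (fun h0 => hu0 (congrArg Subtype.val h0))).1 h ⟨a, ha⟩
  exact ⟨c, (congrArg Subtype.val hc).symm⟩

/-- An ideal of a finite local Gorenstein algebra contains the annihilator of its annihilator. -/
lemma IsGorenstein.mem_of_forall_annihilator [Module.Finite k A] (h : IsGorenstein k A) {j : ℕ}
    (hj : HasSocleDegree A j) (I : Ideal A) {a : A}
    (ha : ∀ b, (∀ c ∈ I, b * c = 0) → a * b = 0) : a ∈ I := by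
  obtain ⟨u, hu, hu0⟩ := Submodule.exists_mem_ne_zero_of_ne_bot hj.1
  have hus := hj.pow_le_socle hu
  -- A functional that is nonzero on the socle vanishes on no nonzero ideal. Hence `(a, b) ↦ ψ (a
  -- b)` is nondegenerate, the orthogonal of an ideal is its annihilator, and the claim is
  -- biorthogonality.
  obtain ⟨ψ, hψ⟩ : ∃ ψ : Module.Dual k A, ψ u ≠ 0 := by
    by_contra! hcon
    exact hu0 ((Module.forall_dual_apply_eq_zero_iff k u).1 hcon)
  have key (J : Ideal A) (hJ : ∀ a ∈ J, ψ a = 0) : J = ⊥ := by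
    by_contra hne
    obtain ⟨v, hvJ, hvs, hv0⟩ := hj.exists_mem_socle hne
    obtain ⟨c, hc⟩ := h.exists_smul_eq hvs hv0 hus
    exact hψ (by rw [hc, map_smul, hJ v hvJ, smul_zero])
  have key' (b : A) (J : Ideal A) (hJ : ∀ a ∈ J, ψ (b * a) = 0) : ∀ a ∈ J, b * a = 0 := by
    intro a ha
    have := key (Ideal.span {b} * J) (fun y hy => by
      obtain ⟨z, hz, rfl⟩ := Ideal.mem_span_singleton_mul.1 hy
      exact hJ z hz)
    have hmem : b * a ∈ Ideal.span {b} * J :=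
      Ideal.mem_span_singleton_mul.2 ⟨a, ha, rfl⟩
    rwa [this, Submodule.mem_bot] at hmem
  let Φ : LinearMap.BilinForm k A := (LinearMap.mul k A).compr₂ ψ
  have hΦ (a b : A) : Φ a b = ψ (a * b) := rfl
  have hrefl : Φ.IsRefl := fun a b hab => by rw [hΦ, mul_comm]; exact hab
  have hnd : Φ.Nondegenerate := by
    refine (LinearMap.IsRefl.nondegenerate_iff_separatingLeft hrefl).2 fun a ha => ?_
    simpa using key' a ⊤ (fun b _ => ha b) 1 trivial
  have horth := LinearMap.BilinForm.orthogonal_orthogonal hnd hrefl (I.restrictScalars k)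
  have : a ∈ I.restrictScalars k := by
    rw [← horth, LinearMap.BilinForm.mem_orthogonal_iff]
    intro b hb
    rw [LinearMap.BilinForm.mem_orthogonal_iff] at hb
    have hb' : ∀ c ∈ I, b * c = 0 := key' b I fun c hc => by
      rw [mul_comm]; exact hb c hc
    rw [hΦ, mul_comm, ha b hb', map_zero]
  exact this

lemma exists_mem_loewy_two_sq_ne_zero [Module.Finite k A] (h2 : (2 : k) ≠ 0)
    (h : IsGorenstein k A) {j : ℕ} (hj2 : 2 ≤ j) (hj : HasSocleDegree A j)
    (hrank : iaRank k A 1 2 ≠ 0) :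
    ∃ x ∈ maximalIdeal A, (∀ a ∈ maximalIdeal A ^ 2, a * x = 0) ∧ x * x ≠ 0 := by
  by_contra! hcon
  have hmul (y : A) (hy : y ∈ iaIdeal A 1 2) (a : A) (ha : a ∈ maximalIdeal A ^ 2) :
      a * y = 0 := by
    rw [mul_comm]; exact Submodule.mem_annihilator.1 hy.2 a ha
  have hsq (y : A) (hy : y ∈ iaIdeal A 1 2) : y * y = 0 :=
    hcon y (by simpa using hy.1) (hmul y hy)
  have horth (y z : A) (hy : y ∈ iaIdeal A 1 2) (hz : z ∈ iaIdeal A 1 2) : y * z = 0 := by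
    have h0 : (2 : k) • (y * z) = 0 := by
      rw [ofNat_smul_eq_nsmul, two_nsmul]
      linear_combination hsq (y + z) (add_mem hy hz) - hsq y hy - hsq z hz
    exact (smul_eq_zero.1 h0).resolve_left h2
  refine hrank ?_
  have hle : iaIdeal A 1 2 ≤ iaIdeal A (1 + 1) 2 ⊔ iaIdeal A 1 (2 - 1) := by
    refine le_sup_of_le_left fun y hy => ⟨?_, hy.2⟩
    refine h.mem_of_forall_annihilator hj _ fun b hb => ?_
    by_cases hbm : b ∈ maximalIdeal A
    · refine horth y b hy ⟨by simpa using hbm, Submodule.mem_annihilator.2 hb⟩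
    -- A unit killing `𝔪²` would give `𝔪² = 0`, against `𝔪ʲ ≠ 0` with `j ≥ 2`.
    · have hbu : IsUnit b := by simpa [mem_maximalIdeal, mem_nonunits_iff] using hbm
      refine absurd (le_bot_iff.1 fun c hc => ?_) hj.1
      exact hbu.mul_right_eq_zero.1 (hb c (Ideal.pow_le_pow_right hj2 hc))
  have hq := finrank_quotient_submoduleOf_add (k := k) (iaIdeal_succ_sup_le (A := A) 1 2)
  have heq := congrArg (fun I : Ideal A => Module.finrank k I)
    (le_antisymm (iaIdeal_succ_sup_le (A := A) 1 2) hle)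
  simp only [iaRank] at heq ⊢
  omega

lemma exists_isSplitting [Module.Finite k A] [IsAlgClosed k] (h2 : (2 : k) ≠ 0)
    (h : IsGorenstein k A) {j : ℕ} (hj3 : 3 ≤ j) (hj : HasSocleDegree A j)
    (hrank : iaRank k A 1 2 ≠ 0) : ∃ (ε : A →ₐ[k] k) (x : A), IsSplitting ε x := by
  obtain ⟨x, hx, hx2, hxx⟩ := exists_mem_loewy_two_sq_ne_zero h2 h (by omega) hj hrank
  let e : k ≃ₐ[k] ResidueField A := AlgEquiv.ofBijective (Algebra.ofId k (ResidueField A))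
    IsAlgClosed.algebraMap_bijective_of_isIntegral
  let ε : A →ₐ[k] k := (e.symm : ResidueField A →ₐ[k] k).comp
    (IsScalarTower.toAlgHom k A (ResidueField A))
  have hsoc : x * x ∈ socle A := Submodule.mem_annihilator.2 fun b hb => by
    rw [smul_eq_mul, mul_assoc, mul_comm]
    exact hx2 _ (by rw [pow_two]; exact Ideal.mul_mem_mul hx hb)
  refine ⟨ε, x, ⟨fun a => ?_, hx, hx2, hxx, ?_, fun a ha => h.exists_smul_eq hsoc hxx
    (Submodule.mem_annihilator.2 ha)⟩⟩
  · rw [← residue_eq_zero_iff]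
    exact map_eq_zero_iff e.symm e.symm.injective
  -- The rank-one socle is spanned by any nonzero element of `𝔪ʲ`, so it lies in `𝔪³`; this is where
  -- `j ≥ 3` enters.
  · obtain ⟨v, hv, hv0⟩ := Submodule.exists_mem_ne_zero_of_ne_bot hj.1
    obtain ⟨c, hc⟩ := h.exists_smul_eq (hj.pow_le_socle hv) hv0 hsoc
    rw [hc]
    exact Submodule.smul_of_tower_mem _ c (Ideal.pow_le_pow_right hj3 hv)

end Existence

end GorensteinDegeneration

namespace GorensteinDegeneration

/-! ### The glued algebra, its family over the line, and its special and general members. -/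

section Gluing

open Polynomial

/-- An augmentation `ε` of the `S`-algebra `B`, together with an element `u` of its kernel which is
killed by that kernel. -/
structure GluingDatum (S B : Type*) [CommRing S] [CommRing B] [Algebra S B] where
  ε : B →ₐ[S] S
  u : B
  eps_u : ε u = 0
  mul_u : ∀ b, b * u = algebraMap S B (ε b) * u

namespace GluingDatum

variable {S B : Type*} [CommRing S] [CommRing B] [Algebra S B]

/-- The `S`-algebra `B[x] / (x ^ 2 - τ x - u, x * ker ε)`, whose elements are written `b + f x` with
`b` in `B` and `f` in `S`. -/
@[ext]
structure Glue (D : GluingDatum S B) (τ : S) where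
  fst : B
  snd : S

variable (D : GluingDatum S B) (τ : S)

/-- The underlying set of the glued algebra is `B × S`. -/
def Glue.equivProd : D.Glue τ ≃ B × S where
  toFun p := (p.1, p.2)
  invFun p := ⟨p.1, p.2⟩
  left_inv _ := rfl
  right_inv _ := rfl

instance : AddCommGroup (D.Glue τ) := (Glue.equivProd D τ).addCommGroup

instance : Module S (D.Glue τ) := (Glue.equivProd D τ).module S

instance [Module.Free S B] : Module.Free S (D.Glue τ) :=
  Module.Free.of_equiv ((Glue.equivProd D τ).linearEquiv S).symm

instance [Module.Finite S B] : Module.Finite S (D.Glue τ) :=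
  Module.Finite.equiv ((Glue.equivProd D τ).linearEquiv S).symm

instance : One (D.Glue τ) := ⟨⟨1, 0⟩⟩

instance : Mul (D.Glue τ) :=
  ⟨fun p q => ⟨p.1 * q.1 + algebraMap S B (p.2 * q.2) * D.u,
    D.ε p.1 * q.2 + D.ε q.1 * p.2 + τ * (p.2 * q.2)⟩⟩

variable {D τ}

@[simp] lemma fst_one : (1 : D.Glue τ).1 = 1 := rfl
@[simp] lemma snd_one : (1 : D.Glue τ).2 = 0 := rfl
@[simp] lemma fst_zero : (0 : D.Glue τ).1 = 0 := rfl
@[simp] lemma snd_zero : (0 : D.Glue τ).2 = 0 := rfl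
@[simp] lemma fst_add (p q : D.Glue τ) : (p + q).1 = p.1 + q.1 := rfl
@[simp] lemma snd_add (p q : D.Glue τ) : (p + q).2 = p.2 + q.2 := rfl
@[simp] lemma fst_smul (s : S) (p : D.Glue τ) : (s • p).1 = s • p.1 := rfl
@[simp] lemma snd_smul (s : S) (p : D.Glue τ) : (s • p).2 = s * p.2 := rfl
@[simp] lemma fst_mul (p q : D.Glue τ) :
    (p * q).1 = p.1 * q.1 + algebraMap S B (p.2 * q.2) * D.u := rfl
@[simp] lemma snd_mul (p q : D.Glue τ) :
    (p * q).2 = D.ε p.1 * q.2 + D.ε q.1 * p.2 + τ * (p.2 * q.2) := rfl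

lemma glue_mul_comm (p q : D.Glue τ) : p * q = q * p := by
  ext
  · simp only [fst_mul, mul_comm]
  · simp only [snd_mul]; ring

lemma glue_one_mul (p : D.Glue τ) : 1 * p = p := by ext <;> simp

lemma glue_left_distrib (p q r : D.Glue τ) : p * (q + r) = p * q + p * r := by
  ext
  · simp only [fst_mul, fst_add, snd_add, map_mul, map_add]; ring
  · simp only [snd_mul, fst_add, snd_add, map_add]; ring

lemma glue_mul_assoc (p q r : D.Glue τ) : p * q * r = p * (q * r) := by
  ext
  · simp only [fst_mul, snd_mul, map_mul, map_add]
    linear_combination (algebraMap S B p.2 * algebraMap S B q.2) * D.mul_u r.1 -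
      (algebraMap S B q.2 * algebraMap S B r.2) * D.mul_u p.1
  · simp only [fst_mul, snd_mul, map_mul, map_add, D.eps_u, AlgHom.commutes,
      Algebra.algebraMap_self, RingHom.id_apply]
    ring

instance : CommRing (D.Glue τ) :=
  { (inferInstance : AddCommGroup (D.Glue τ)) with
    mul := (· * ·)
    one := 1
    mul_assoc := glue_mul_assoc
    one_mul := glue_one_mul
    mul_one := fun p => by rw [glue_mul_comm, glue_one_mul]
    mul_comm := glue_mul_comm
    zero_mul := fun p => by ext <;> simp
    mul_zero := fun p => by ext <;> simp
    left_distrib := glue_left_distrib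
    right_distrib := fun p q r => by
      rw [glue_mul_comm, glue_left_distrib, glue_mul_comm r, glue_mul_comm r] }

instance : Algebra S (D.Glue τ) :=
  Algebra.ofModule
    (fun s p q => by
      ext
      · simp only [fst_mul, fst_smul, snd_smul, Algebra.smul_def, map_mul]; ring
      · simp only [snd_mul, fst_smul, snd_smul, map_smul, smul_eq_mul]; ring)
    (fun s p q => by
      ext
      · simp only [fst_mul, fst_smul, snd_smul, Algebra.smul_def, map_mul]; ring
      · simp only [snd_mul, fst_smul, snd_smul, map_smul, smul_eq_mul]; ring)

@[simp] lemma fst_algebraMap (s : S) : (algebraMap S (D.Glue τ) s).1 = algebraMap S B s := by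
  rw [Algebra.algebraMap_eq_smul_one, fst_smul, fst_one, Algebra.algebraMap_eq_smul_one]

@[simp] lemma snd_algebraMap (s : S) : (algebraMap S (D.Glue τ) s).2 = 0 := by
  rw [Algebra.algebraMap_eq_smul_one, snd_smul, snd_one, mul_zero]

attribute [local instance] Polynomial.algebra

variable (D) in
/-- The datum over `S[X]` obtained by base change. -/
noncomputable def poly : GluingDatum S[X] B[X] where
  ε := { mapRingHom (D.ε : B →+* S) with
    commutes' := fun p => by
      ext n
      simp }
  u := C D.u
  eps_u := by
    change (C D.u).map (D.ε : B →+* S) = 0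
    simp [D.eps_u]
  mul_u b := by
    change b * C D.u = (b.map (D.ε : B →+* S)).map (algebraMap S B) * C D.u
    ext n
    simp [D.mul_u (b.coeff n)]

lemma poly_eps (p : B[X]) : D.poly.ε p = p.map (D.ε : B →+* S) := rfl

lemma poly_u : D.poly.u = C D.u := rfl

lemma eps_eval (c : S) (p : B[X]) :
    D.ε (p.eval (algebraMap S B c)) = (p.map (D.ε : B →+* S)).eval c := by
  rw [Polynomial.eval_map, ← Polynomial.eval₂_id, ← RingHom.coe_coe D.ε, Polynomial.hom_eval₂]
  simp

lemma eval_algebraMap (c : S) (p : S[X]) :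
    (algebraMap S[X] B[X] p).eval (algebraMap S B c) = algebraMap S B (p.eval c) := by
  simp [aeval_algebraMap_apply]

variable (D) in
/-- Specialization of the family `D.poly.Glue X` at the point `c`. -/
noncomputable def specialize (c : S) : D.poly.Glue X →+* D.Glue c where
  toFun p := ⟨p.1.eval (algebraMap S B c), p.2.eval c⟩
  map_one' := by ext <;> simp
  map_zero' := by ext <;> simp
  map_add' p q := by ext <;> simp
  map_mul' p q := by
    ext
    · simp only [fst_mul, eval_add, eval_mul, eval_algebraMap, poly_u, eval_C]
    · simp only [snd_mul, eval_add, eval_mul, poly_eps, ← eps_eval, eval_X]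

@[simp] lemma fst_specialize (c : S) (p : D.poly.Glue X) :
    (D.specialize c p).1 = p.1.eval (algebraMap S B c) := rfl

@[simp] lemma snd_specialize (c : S) (p : D.poly.Glue X) :
    (D.specialize c p).2 = p.2.eval c := rfl

lemma specialize_surjective (c : S) : Function.Surjective (D.specialize c) := fun p =>
  ⟨⟨C p.1, C p.2⟩, by ext <;> simp⟩

lemma specialize_algebraMap (c : S) (p : S[X]) :
    D.specialize c (algebraMap S[X] (D.poly.Glue X) p) = algebraMap S (D.Glue c) (p.eval c) := by
  ext
  · rw [fst_specialize, fst_algebraMap, eval_algebraMap, fst_algebraMap]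
  · simp

/-- Both coordinates vanish at `c`, so the factor theorem applies to each. -/
lemma exists_smul_of_specialize_eq_zero {c : S} {p : D.poly.Glue X} (hp : D.specialize c p = 0) :
    ∃ q : D.poly.Glue X, p = (X - C c : S[X]) • q := by
  have h1 : p.1.IsRoot (algebraMap S B c) := congrArg Glue.fst hp
  have h2 : p.2.IsRoot c := congrArg Glue.snd hp
  obtain ⟨q₁, hq₁⟩ := dvd_iff_isRoot.2 h1
  obtain ⟨q₂, hq₂⟩ := dvd_iff_isRoot.2 h2
  refine ⟨⟨q₁, q₂⟩, ?_⟩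
  ext1
  · rw [fst_smul, hq₁, Algebra.smul_def]
    simp
  · rw [snd_smul, hq₂]

instance [Module.Free S B] : Module.Free S[X] B[X] :=
  Module.Free.of_equiv (Algebra.IsPushout.out (R := S) (S := S[X]) (R' := B) (S' := B[X])).equiv

instance [Module.Finite S B] : Module.Finite S[X] B[X] :=
  Module.Finite.equiv (Algebra.IsPushout.out (R := S) (S := S[X]) (R' := B) (S' := B[X])).equiv

end GluingDatum

section Field

variable {k B : Type*} [Field k] [CommRing B] [Algebra k B] (D : GluingDatum k B)

namespace GluingDatum

lemma u_mul_u : D.u * D.u = 0 := by rw [D.mul_u, D.eps_u, map_zero, zero_mul]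

/-- If `c` is invertible, the idempotent `c⁻¹ (x + c⁻¹ u)` splits off a factor `k`. -/
noncomputable def glueEquivProd {c : k} (hc : c ≠ 0) : D.Glue c ≃ₐ[k] k × B where
  -- The factors send `x` to `c` and to `-c⁻¹ u`. Both satisfy `x² = c x + u`, as `u` maps to `0` in
  -- `k` and `u² = 0` in `B`.
  toFun p := (D.ε p.1 + c * p.2, p.1 - algebraMap k B (c⁻¹ * p.2) * D.u)
  invFun q := ⟨q.2 + algebraMap k B (c⁻¹ * (c⁻¹ * (q.1 - D.ε q.2))) * D.u,
    c⁻¹ * (q.1 - D.ε q.2)⟩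
  left_inv p := by
    have h : c⁻¹ * (D.ε p.1 + c * p.2 - D.ε (p.1 - algebraMap k B (c⁻¹ * p.2) * D.u)) = p.2 := by
      simp [D.eps_u, inv_mul_cancel_left₀ hc]
    ext1
    · simp only [h]; ring
    · exact h
  right_inv q := by
    ext
    · simp [D.eps_u, mul_inv_cancel_left₀ hc]
    · simp
  map_mul' p q := by
    have hcc : algebraMap k B c⁻¹ * algebraMap k B c = 1 := by
      rw [← map_mul, inv_mul_cancel₀ hc, map_one]
    ext
    · simp only [GluingDatum.fst_mul, GluingDatum.snd_mul, map_add, map_mul, D.eps_u,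
        Prod.fst_mul]
      ring
    · simp only [GluingDatum.fst_mul, GluingDatum.snd_mul, map_add, map_mul, Prod.snd_mul]
      linear_combination -(algebraMap k B p.2 * algebraMap k B q.2 * D.u) * hcc +
        (algebraMap k B c⁻¹ * algebraMap k B q.2) * D.mul_u p.1 +
        (algebraMap k B c⁻¹ * algebraMap k B p.2) * D.mul_u q.1 -
        (algebraMap k B c⁻¹ ^ 2 * algebraMap k B p.2 * algebraMap k B q.2) * D.u_mul_u
  map_add' p q := by
    ext
    · simp only [fst_add, snd_add, map_add, Prod.fst_add]; ring
    · simp only [fst_add, snd_add, map_add, map_mul, Prod.snd_add]; ring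
  commutes' s := by ext <;> simp

end GluingDatum

end Field

section Splitting

variable {k A : Type*} [Field k] [CommRing A] [IsLocalRing A] [Algebra k A]
  {ε : A →ₐ[k] k} {x : A}

/-- The datum on `k + Ann x` given by the element `x ^ 2`. -/
def IsSplitting.datum (h : IsSplitting ε x) : GluingDatum k (annSubalgebra ε x) where
  ε := ε.comp (annSubalgebra ε x).val
  u := ⟨x * x, h.sq_mem_annSubalgebra⟩
  eps_u := by simp [(h.eps_eq_zero_iff x).2 h.mem]
  mul_u b := by
    refine Subtype.ext ?_
    change (b : A) * (x * x) = algebraMap k A (ε b) * (x * x)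
    rw [← mul_assoc, mem_annSubalgebra.1 b.2, Algebra.smul_def, mul_assoc]

/-- Gluing `x` back to `k + Ann x` recovers the algebra `A`. -/
noncomputable def IsSplitting.glueEquiv (h : IsSplitting ε x) : h.datum.Glue 0 ≃ₐ[k] A := by
  let f : h.datum.Glue 0 →ₐ[k] A :=
    { toFun := fun p => (p.1 : A) + algebraMap k A p.2 * x
      map_one' := by simp
      map_zero' := by simp
      map_add' := fun p q => by
        simp only [GluingDatum.fst_add, GluingDatum.snd_add, map_add]; push_cast; ring
      map_mul' := fun p q => by
        have hp : (p.1 : A) * x = algebraMap k A (ε p.1) * x := by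
          rw [mem_annSubalgebra.1 p.1.2, Algebra.smul_def]
        have hq : (q.1 : A) * x = algebraMap k A (ε q.1) * x := by
          rw [mem_annSubalgebra.1 q.1.2, Algebra.smul_def]
        have h1 : ((p * q).1 : A) = p.1 * q.1 + algebraMap k A (p.2 * q.2) * (x * x) := rfl
        have h2 : (p * q).2 = ε p.1 * q.2 + ε q.1 * p.2 + 0 * (p.2 * q.2) := rfl
        rw [h1, h2]
        simp only [map_add, map_mul, map_zero]
        linear_combination -(algebraMap k A q.2) * hp - (algebraMap k A p.2) * hq
      commutes' := fun s => by simp }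
  refine AlgEquiv.ofBijective f ⟨?_, fun a => ?_⟩
  · rw [injective_iff_map_eq_zero]
    intro p hp
    have hp' : (p.1 : A) + algebraMap k A p.2 * x = 0 := hp
    have hs : p.2 = 0 := by
      by_contra hs
      apply h.not_mem_annSubalgebra
      have hmem := (-(p.2)⁻¹ • p.1).2
      have : x = -(p.2)⁻¹ • (p.1 : A) := by
        rw [eq_neg_of_add_eq_zero_left hp', smul_neg, neg_smul, neg_neg, ← Algebra.smul_def,
          smul_smul, inv_mul_cancel₀ hs, one_smul]
      rwa [Subalgebra.coe_smul, ← this] at hmem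
    rw [hs, map_zero, zero_mul, add_zero] at hp'
    exact GluingDatum.Glue.ext (Subtype.ext hp') hs
  · obtain ⟨c, hc⟩ := h.exists_sub_smul_mem a
    refine ⟨⟨⟨_, hc⟩, c⟩, ?_⟩
    change a - c • x + algebraMap k A c * x = a
    rw [Algebra.smul_def]; ring

end Splitting

end Gluing

/-! ### From algebras to schemes: fibres, disjoint unions and flatness. -/

section Geometry

universe u

open Polynomial

lemma liftOfSurjective_apply {R E Z : Type*} [CommRing R] [CommRing E] [CommRing Z] (i : R →+* E)
    (hi : Function.Surjective i) (φ : {φ : R →+* Z // RingHom.ker i ≤ RingHom.ker φ}) (r : R) :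
    RingHom.liftOfSurjective i hi φ (i r) = φ.1 r :=
  RingHom.liftOfRightInverse_comp_apply i _ (Function.rightInverse_surjInv hi) φ r

/-- The hypotheses identify `E` with the quotient of `R` by the ideal generated by `f (ker g)`,
which is the pushout along a surjective `g`. -/
lemma isPushout_of_surjective {S R T E : Type u} [CommRing S] [CommRing R] [CommRing T]
    [CommRing E] (f : S →+* R) (g : S →+* T) (i : R →+* E) (l : T →+* E)
    (hcomm : i.comp f = l.comp g) (hg : Function.Surjective g) (hi : Function.Surjective i)
    (hker : ∀ r, i r = 0 → ∃ s r', g s = 0 ∧ r = f s * r') :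
    IsPushout (CommRingCat.ofHom f) (CommRingCat.ofHom g) (CommRingCat.ofHom i)
      (CommRingCat.ofHom l) := by
  have hcond (s : PushoutCocone (CommRingCat.ofHom f) (CommRingCat.ofHom g)) (a : S) :
      s.inl.hom (f a) = s.inr.hom (g a) := congrArg (fun φ => φ.hom a) s.condition
  have hdesc (s : PushoutCocone (CommRingCat.ofHom f) (CommRingCat.ofHom g)) :
      RingHom.ker i ≤ RingHom.ker s.inl.hom := fun r hr => by
    obtain ⟨a, r', ha, rfl⟩ := hker r hr
    rw [RingHom.mem_ker, map_mul, hcond, ha, map_zero, zero_mul]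
  refine ⟨⟨by rw [← CommRingCat.ofHom_comp, hcomm, CommRingCat.ofHom_comp]⟩,
    ⟨PushoutCocone.IsColimit.mk _
      (fun s => CommRingCat.ofHom (RingHom.liftOfSurjective i hi ⟨s.inl.hom, hdesc s⟩))
      (fun s => ?_) (fun s => ?_) (fun s m h₁ h₂ => ?_)⟩⟩
  · ext r
    exact liftOfSurjective_apply i hi ⟨s.inl.hom, hdesc s⟩ r
  · ext t
    obtain ⟨a, rfl⟩ := hg t
    have h : i (f a) = l (g a) := RingHom.congr_fun hcomm a
    change RingHom.liftOfSurjective i hi _ (l (g a)) = s.inr.hom (g a)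
    rw [← hcond, ← h]
    exact liftOfSurjective_apply i hi ⟨s.inl.hom, hdesc s⟩ (f a)
  · ext e
    obtain ⟨r, rfl⟩ := hi e
    have h : m.hom (i r) = s.inl.hom r := congrArg (fun φ => φ.hom r) h₁
    exact h.trans (liftOfSurjective_apply i hi ⟨s.inl.hom, hdesc s⟩ r).symm

variable {k : Type u} [Field k]

/-- Isomorphic algebras have isomorphic spectra over the base. -/
noncomputable def specOverIso {A B : Type u} [CommRing A] [CommRing B] [Algebra k A] [Algebra k B]
    (e : A ≃ₐ[k] B) : specOver k A ≅ specOver k B :=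
  Over.isoMk (Scheme.Spec.mapIso e.toRingEquiv.toCommRingCatIso.op.symm) (by
    change Spec.map (CommRingCat.ofHom (e.symm : B →+* A)) ≫
      Spec.map (CommRingCat.ofHom (algebraMap k B)) = Spec.map (CommRingCat.ofHom (algebraMap k A))
    rw [← Spec.map_comp, ← CommRingCat.ofHom_comp]
    congr 2
    ext c
    exact e.symm.commutes c)

/-- The spectrum of a product is the disjoint union of the spectra. -/
noncomputable def specOverProdIso (A B : Type u) [CommRing A] [CommRing B] [Algebra k A]
    [Algebra k B] : specOver k (A × B) ≅ disjointUnion (specOver k A) (specOver k B) :=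
  let e : Spec (.of A) ⨿ Spec (.of B) ≅ Spec (.of (A × B)) := asIso (coprodSpec A B)
  (Over.isoMk (f := disjointUnion (specOver k A) (specOver k B))
    (g := specOver k (A × B)) e (by
    change coprodSpec A B ≫ Spec.map (CommRingCat.ofHom (algebraMap k (A × B))) =
      coprod.desc (Spec.map (CommRingCat.ofHom (algebraMap k A)))
        (Spec.map (CommRingCat.ofHom (algebraMap k B)))
    apply coprod.hom_ext
    · rw [coprodSpec_inl_assoc, coprod.inl_desc, ← Spec.map_comp]; rfl
    · rw [coprodSpec_inr_assoc, coprod.inr_desc, ← Spec.map_comp]; rfl)).symm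

/-- A fibre of a family of affine schemes over the line, computed by a pushout of rings. -/
noncomputable def fibreAtIso {R E : Type u} [CommRing R] [CommRing E] [Algebra k E] (f : k[X] →+* R)
    (c : k) (i : R →+* E)
    (h : IsPushout (CommRingCat.ofHom f) (CommRingCat.ofHom (evalRingHom c)) (CommRingCat.ofHom i)
      (CommRingCat.ofHom (algebraMap k E))) :
    fibreAt (Spec.map (CommRingCat.ofHom f)) c ≅ specOver k E :=
  Over.isoMk (isPullback_SpecMap_of_isPushout _ _ _ _ h).isoPullback.symm
    (IsPullback.isoPullback_inv_snd _)

attribute [local instance] Polynomial.algebra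

/-- The family with parameter `X` has underlying module `B[X] × k[X]`, finite and free over `k[X]`,
hence finite and flat. -/
lemma isFlatDegeneration_glue {B : Type u} [CommRing B] [Algebra k B] [Module.Finite k B]
    (D : GluingDatum k B) :
    IsFlatDegeneration (specOver k (D.Glue 0)) (disjointUnion (specOver k k) (specOver k B)) := by
  have hfibre (c : k) : Nonempty (fibreAt
      (Spec.map (CommRingCat.ofHom (algebraMap k[X] (D.poly.Glue X)))) c ≅
      specOver k (D.Glue c)) := by
    refine ⟨fibreAtIso _ c (D.specialize c) (isPushout_of_surjective _ _ _ _ ?_ ?_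
      (GluingDatum.specialize_surjective c) fun r hr => ?_)⟩
    · exact RingHom.ext fun p => GluingDatum.specialize_algebraMap c p
    · exact fun a => ⟨C a, by simp⟩
    · obtain ⟨q, hq⟩ := GluingDatum.exists_smul_of_specialize_eq_zero hr
      exact ⟨X - C c, q, by simp, by rw [hq, Algebra.smul_def]⟩
  refine ⟨_, Spec.map (CommRingCat.ofHom (algebraMap k[X] (D.poly.Glue X))), ?_, ?_, hfibre 0,
    fun c hc => ?_⟩
  · rw [Flat.SpecMap_iff]
    exact RingHom.flat_algebraMap_iff.2 inferInstance
  · rw [IsFinite.SpecMap_iff]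
    exact RingHom.finite_algebraMap.2 inferInstance
  · obtain ⟨φ⟩ := hfibre c
    exact ⟨φ ≪≫ specOverIso (D.glueEquivProd hc) ≪≫ specOverProdIso k B⟩

end Geometry

end GorensteinDegeneration

open GorensteinDegeneration in
lemma GorensteinDegeneration.IsFlatDegeneration.congr_left {k : Type*} [Field k]
    {X X' Z : Over (Spec (CommRingCat.of k))} (e : X ≅ X') (h : IsFlatDegeneration X Z) :
    IsFlatDegeneration X' Z := by
  obtain ⟨Y, π, hflat, hfin, ⟨φ⟩, hgen⟩ := h
  exact ⟨Y, π, hflat, hfin, ⟨φ ≪≫ e⟩, hgen⟩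

theorem mainTheorem6 (A : Type) [CommRing A] [Algebra ℂ A] [IsLocalRing A] [Module.Finite ℂ A]
    (j e : ℕ) (hj : 3 ≤ j) (he : 0 < e)
    (hGor : GorensteinDegeneration.IsGorenstein ℂ A)
    (hsoc : GorensteinDegeneration.HasSocleDegree A j)
    (hΔ : ∀ t : ℕ, GorensteinDegeneration.hilbertDecomp ℂ A j (j - 2) t = if t = 1 then e else 0) :
    ∃ (B : Type) (_ : CommRing B) (_ : Algebra ℂ B) (_ : IsLocalRing B) (_ : Module.Finite ℂ B),
      GorensteinDegeneration.IsGorenstein ℂ B ∧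
      GorensteinDegeneration.HasSocleDegree B j ∧
      (∀ s t : ℕ, s ≠ j - 2 →
        GorensteinDegeneration.hilbertDecomp ℂ B j s t =
          GorensteinDegeneration.hilbertDecomp ℂ A j s t) ∧
      (∀ t : ℕ, GorensteinDegeneration.hilbertDecomp ℂ B j (j - 2) t =
        if t = 1 then e - 1 else 0) ∧
      GorensteinDegeneration.IsFlatDegeneration
        (GorensteinDegeneration.specOver ℂ A)
        (GorensteinDegeneration.disjointUnion
          (GorensteinDegeneration.specOver ℂ ℂ)
          (GorensteinDegeneration.specOver ℂ B)) := by
  -- At `s = j - 2`, `t = 1` the second index is `j + 1 - (j - 1) = 2`.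
  have hrank : GorensteinDegeneration.iaRank ℂ A 1 2 = e := by
    have h1 := hΔ 1
    rwa [if_pos rfl, GorensteinDegeneration.hilbertDecomp, if_pos (by omega),
      show j + 1 - (j - 2 + 1) = 2 by omega] at h1
  obtain ⟨ε, x, h⟩ := GorensteinDegeneration.exists_isSplitting two_ne_zero hGor hj hsoc
    (by omega : GorensteinDegeneration.iaRank ℂ A 1 2 ≠ 0)
  refine ⟨GorensteinDegeneration.annSubalgebra ε x, inferInstance, inferInstance, inferInstance,
    inferInstance, h.isGorenstein_annSubalgebra, h.hasSocleDegree_annSubalgebra (by omega) hsoc,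
    fun s t hs => h.hilbertDecomp_of_ne (by omega) hs t, fun t => ?_,
    (GorensteinDegeneration.isFlatDegeneration_glue h.datum).congr_left
      (GorensteinDegeneration.specOverIso h.glueEquiv)⟩
  have ht := hΔ t
  rw [h.hilbertDecomp_eq (by omega)] at ht
  split_ifs at * <;> omega
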